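/- Let $A$ be a finite set of agents and $G$ a finite set of items with $|A| = |G|$, and let $u = (u_{ij})_{i \in A, j \in G}$ be arbitrary real utilities (of any sign: goods, chores, or mixed manna; in particular they may be rational). Then an HZ (Hylland–Zeckhauser) earnings equilibrium exists, that is, there are a real allocation $x = (x_{ij})_{i\in A, j\in G}$ and real payments $p = (p_j)_{j \in G}$, both non-negative, such that: 1. $\sum_{j \in G} x_{ij} = 1$ for all $i \in A$; 2. $\sum_{i \in A} x_{ij} = 1$ for all $j \in G$; 3. $p \cdot x_i = \sum_{j \in G} p_j x_{ij} \ge 1$ for all $i \in A$; 4. for every $i \in A$ and every $y = (y_j)_{j \in G}$ with $y \ge 0$, $\sum_{j \in G} y_j = 1$ and $p \cdot y \ge 1$, we have $u_i \cdot y \le u_i \cdot x_i$, and if $u_i \cdot y = u_i \cdot x_i$, then $p \cdot y \le p \cdot x_i$. -/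

import Mathlib

/-- A bundle: a nonnegative vector over the items with total amount one. -/
structure IsBundle {G : Type*} [Fintype G] (y : G → ℝ) : Prop where
  nonneg : ∀ j, 0 ≤ y j
  sum_eq_one : ∑ j, y j = 1

/-- `(x, p)` is an HZ earnings equilibrium of the market with agents `A`, items `G` and
utilities `u`. -/
structure IsHZEarningsEquilibrium {A G : Type*} [Fintype A] [Fintype G]
    (u x : A → G → ℝ) (p : G → ℝ) : Prop where
  alloc_nonneg : ∀ i j, 0 ≤ x i j
  payment_nonneg : ∀ j, 0 ≤ p j
  /-- Each agent is fully matched. -/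
  agent_matched : ∀ i, ∑ j, x i j = 1
  /-- Each item is fully matched. -/
  item_matched : ∀ j, ∑ i, x i j = 1
  /-- No agent under-earns. -/
  earns : ∀ i, 1 ≤ p ⬝ᵥ x i
  /-- Every agent gets an optimal bundle among those that earn at least one. -/
  optimal : ∀ i, ∀ y : G → ℝ, IsBundle y → 1 ≤ p ⬝ᵥ y → u i ⬝ᵥ y ≤ u i ⬝ᵥ x i
  /-- Among its optimal bundles, every agent gets a highest-earning one. -/
  highest_earning : ∀ i, ∀ y : G → ℝ, IsBundle y → 1 ≤ p ⬝ᵥ y →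
    u i ⬝ᵥ y = u i ⬝ᵥ x i → p ⬝ᵥ y ≤ p ⬝ᵥ x i

/-!
Since bundles have total amount one, the payments `1 + s * (1 - q j)` with `s > 0` turn the
constraint "earns at least one" into the budget constraint `q ⬝ᵥ y ≤ 1`, and "earns most" into
"costs least". For small `s` they are non-negative, so it suffices to find a Hylland–Zeckhauser
equilibrium with prices `q ≥ 0` and unit budgets, in which each agent gets a cheapest optimal
bundle. The sign of the utilities plays no role.

Such an equilibrium is a limit of regularized ones (`exists_regularized_equilibrium`). Agent `i`
demands the logit distribution with weights `exp ((u i j - l i * p j) / ε)`, where the multiplier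
`l i ≥ δ` of the budget constraint is raised above `δ` only if the budget is exhausted, and prices
are measured from the cheapest item. A complementarity problem on a box of prices and multipliers,
solved through Brouwer's theorem, yields market clearing: the upper bound on multipliers is not
reached, as agents that sensitive to cost spend almost nothing, and the upper bound on prices is not
reached, as the total budget would be exceeded. With `ε = δ ^ 2` and `δ → 0`, compactness gives a
limit (`exists_supported_equilibrium`). Multipliers stay bounded, so agents buy maximizers of
`u i j - l i * p j`; and because `δ / ε → ∞`, they buy only the cheapest among items of equal
utility, even if their multiplier tends to zero. `IsBundle.optimal_and_cheapest` concludes.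

The fixed point theorem, for compactly supported continuous self-maps of `ι → ℝ`, is proved
analytically. For `g` of class `C¹` with support in a compact set `K`, the integral over `K` of
`ρ (x + t • g x) * det (1 + t • Dg x)`, with `ρ` polynomial, is polynomial in `t`; it is constant
for small `t` by change of variables, hence also at `t = 1` (`setIntegral_comp_mul_det_eq`). Applied
to `-g` and to functions `ρ` that concentrate at the origin, this forces `x - g x` to vanish
somewhere. Smooth approximation extends the result to continuous maps.
-/

/-! ### Brouwer's fixed point theorem -/

open MeasureTheory Set in
/-- For small `t` the perturbation `x ↦ x + t • g x` of the identity is a diffeomorphism carrying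
`K` onto itself, with positive Jacobian determinant, so that it preserves integrals over `K`. -/
theorem exists_pos_setIntegral_comp_mul_det_eq {E : Type*} [NormedAddCommGroup E]
    [NormedSpace ℝ E] [FiniteDimensional ℝ E] [MeasurableSpace E] [BorelSpace E]
    (μ : Measure E) [μ.IsAddHaarMeasure] {g : E → E} (hg : ContDiff ℝ 1 g) {K : Set E}
    (hK : IsCompact K) (hgK : ∀ x ∉ K, g x = 0) :
    ∃ t₀ : ℝ, 0 < t₀ ∧ ∀ t ∈ Icc 0 t₀, ∀ ρ : E → ℝ,
      ∫ x in K, ρ (x + t • g x) * (1 + t • fderiv ℝ g x).det ∂μ = ∫ x in K, ρ x ∂μ := by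
  have hcs : HasCompactSupport g := HasCompactSupport.intro hK hgK
  obtain ⟨C, hC⟩ := hg.lipschitzWith_of_hasCompactSupport hcs one_ne_zero
  have hdet : ∀ᶠ A : E →L[ℝ] E in nhds 1, 0 < A.det := by
    refine (ContinuousLinearMap.continuous_det.tendsto (1 : E →L[ℝ] E)).eventually
      (lt_mem_nhds ?_)
    have : (1 : E →L[ℝ] E).det = 1 := LinearMap.det_id
    rw [this]
    exact one_pos
  obtain ⟨η, hη, hηdet⟩ := Metric.eventually_nhds_iff.1 hdet
  obtain ⟨t₀, ht₀, ht₀1, ht₀η⟩ : ∃ t₀ : ℝ, 0 < t₀ ∧ t₀ * C < 1 ∧ t₀ * C < η := by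
    have hC0 : (0 : ℝ) < C + 1 := by positivity
    have hm : 0 < min 1 η := lt_min one_pos hη
    refine ⟨min 1 η / (C + 1), by positivity, ?_⟩
    have : min 1 η / (C + 1) * C < min 1 η := by
      rw [div_mul_eq_mul_div, div_lt_iff₀ hC0]
      nlinarith
    exact ⟨this.trans_le (min_le_left _ _), this.trans_le (min_le_right _ _)⟩
  refine ⟨t₀, ht₀, fun t ht ρ => ?_⟩
  have htC : t * C ≤ t₀ * C := mul_le_mul_of_nonneg_right ht.2 C.2
  have hlip : ∀ x y, ‖t • g x - t • g y‖ ≤ t * C * ‖x - y‖ := fun x y => by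
    rw [← smul_sub, norm_smul, Real.norm_of_nonneg ht.1, mul_assoc]
    exact mul_le_mul_of_nonneg_left (hC.norm_sub_le x y) ht.1
  set φ : E → E := fun x => x + t • g x with hφ
  have hinj : Function.Injective φ := by
    intro x y hxy
    have h1 : x - y = -(t • g x - t • g y) := by
      simp only [hφ] at hxy
      rw [← sub_eq_zero] at hxy ⊢
      rw [← hxy]; abel
    have h2 := hlip x y
    rw [← norm_neg (t • g x - t • g y), ← h1] at h2
    by_contra hne
    have : 0 < ‖x - y‖ := norm_pos_iff.2 (sub_ne_zero.2 hne)
    nlinarith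
  have hsurj : Function.Surjective φ := by
    intro y
    have hcontr : ContractingWith ⟨t * C, mul_nonneg ht.1 C.2⟩ (fun x => y - t • g x) := by
      refine ⟨NNReal.coe_lt_coe.1 (htC.trans_lt ht₀1), ?_⟩
      refine LipschitzWith.of_dist_le_mul fun a b => ?_
      rw [dist_eq_norm, dist_eq_norm, sub_sub_sub_cancel_left, norm_sub_rev a b]
      exact hlip b a
    obtain ⟨x, hx, -⟩ := hcontr.exists_fixedPoint y (edist_ne_top _ _)
    refine ⟨x, ?_⟩
    have hx' : y - t • g x = x := hx
    exact (eq_sub_iff_add_eq.1 hx'.symm)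
  have himage : φ '' K = K := by
    have hout : ∀ x ∉ K, φ x = x := fun x hx => by simp [hφ, hgK x hx]
    apply Subset.antisymm
    · rintro _ ⟨x, hx, rfl⟩
      by_contra h
      exact h (by rwa [hinj (hout _ h)])
    · intro y hy
      obtain ⟨x, rfl⟩ := hsurj y
      by_contra h
      have hx : x ∉ K := fun hx => h ⟨x, hx, rfl⟩
      rw [hout x hx] at hy
      exact hx hy
  have hderiv : ∀ x ∈ K, HasFDerivWithinAt φ (1 + t • fderiv ℝ g x) K x := fun x _ =>
    ((hasFDerivAt_id x).add
      (((hg.differentiable one_ne_zero) x).hasFDerivAt.const_smul t)).hasFDerivWithinAt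
  have hpos : ∀ x, 0 < (1 + t • fderiv ℝ g x).det := fun x => by
    refine hηdet ?_
    rw [dist_eq_norm, add_sub_cancel_left, norm_smul, Real.norm_of_nonneg ht.1]
    exact ((mul_le_mul_of_nonneg_left (norm_fderiv_le_of_lipschitz ℝ hC) ht.1).trans
      htC).trans_lt ht₀η
  have key := integral_image_eq_integral_abs_det_fderiv_smul μ hK.measurableSet hderiv
    hinj.injOn ρ
  rw [himage] at key
  rw [key]
  refine integral_congr_ae (Filter.Eventually.of_forall fun x => ?_)
  simp only [abs_of_pos (hpos x), smul_eq_mul, hφ, mul_comm]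

open MeasureTheory Polynomial in
/-- Integrating a family of functions that is polynomial in a parameter, with continuous functions
as coefficients, gives a polynomial in the parameter. -/
theorem exists_polynomial_setIntegral_eval₂ {E : Type*} [TopologicalSpace E] [T2Space E]
    [MeasurableSpace E] [OpensMeasurableSpace E] (μ : Measure E)
    [IsFiniteMeasureOnCompacts μ] {K : Set E} (hK : IsCompact K) (p : C(E, ℝ)[X]) :
    ∃ P : ℝ[X], ∀ t : ℝ,
      ∫ x in K, p.eval₂ (ContinuousMap.evalAlgHom ℝ ℝ x : C(E, ℝ) →+* ℝ) t ∂μ = P.eval t := by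
  refine ⟨∑ n ∈ p.support, monomial n (∫ x in K, p.coeff n x ∂μ), fun t => ?_⟩
  simp only [eval₂_eq_sum, Polynomial.sum]
  rw [integral_finsetSum, eval_finsetSum]
  · refine Finset.sum_congr rfl fun n _ => ?_
    rw [eval_monomial, ← integral_mul_const]
    rfl
  · intro n _
    exact (((p.coeff n).continuous.mul continuous_const).continuousOn).integrableOn_compact hK

open MeasureTheory Set Polynomial in
/-- Change of variables for `x ↦ x + g x`, with the signed Jacobian determinant and without any
injectivity: replacing `g` by `t • g`, the left-hand side is polynomial in `t`, and it is constant
for small `t ≥ 0`. -/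
theorem setIntegral_comp_mul_det_eq {ι : Type*} [Fintype ι] {g : (ι → ℝ) → ι → ℝ}
    (hg : ContDiff ℝ 1 g) {K : Set (ι → ℝ)} (hK : IsCompact K) (hgK : ∀ x ∉ K, g x = 0)
    (ρ : MvPolynomial ι ℝ) :
    ∫ x in K, MvPolynomial.eval (x + g x) ρ * (1 + fderiv ℝ g x).det
      = ∫ x in K, MvPolynomial.eval x ρ := by
  classical
  let G : ι → C(ι → ℝ, ℝ) := fun i => ⟨fun x => g x i, by
    have := hg.continuous; fun_prop⟩
  let J : ι → ι → C(ι → ℝ, ℝ) := fun i j =>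
    ⟨fun x => fderiv ℝ g x (Pi.single j 1) i, by
      have := (hg.continuous_fderiv one_ne_zero)
      fun_prop⟩
  let Y : ι → C(ι → ℝ, ℝ) := fun i => ⟨fun x => x i, by fun_prop⟩
  -- Evaluated at `x` and `t`, this is `ρ (x + t • g x)` times the Jacobian determinant there.
  let p : C(ι → ℝ, ℝ)[X] :=
    MvPolynomial.aeval (fun i => C (Y i) + X * C (G i)) ρ *
      (Matrix.of fun i j => C (if i = j then 1 else 0) + X * C (J i j) :
        Matrix ι ι C(ι → ℝ, ℝ)[X]).det
  have hp : ∀ t x, p.eval₂ (ContinuousMap.evalAlgHom ℝ ℝ x : C(ι → ℝ, ℝ) →+* ℝ) t =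
      MvPolynomial.eval (x + t • g x) ρ * (1 + t • fderiv ℝ g x).det := by
    intro t x
    let e : C(ι → ℝ, ℝ)[X] →+* ℝ :=
      eval₂RingHom (ContinuousMap.evalAlgHom ℝ ℝ x : C(ι → ℝ, ℝ) →+* ℝ) t
    have he : ∀ a, e (C a) = a x := fun a => by simp [e]
    have heX : e X = t := by simp [e]
    change e p = _
    simp only [p]
    rw [map_mul, RingHom.map_det]
    congr 1
    · rw [MvPolynomial.aeval_def, MvPolynomial.hom_eval₂, ← MvPolynomial.eval₂_id]
      congr 1
      · ext a
        simp [e]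
      · ext i
        simp [he, heX, Y, G]
        ring
    · change _ = LinearMap.det ((1 + t • fderiv ℝ g x : (ι → ℝ) →L[ℝ] ι → ℝ) :
        (ι → ℝ) →ₗ[ℝ] ι → ℝ)
      rw [← LinearMap.det_toMatrix']
      congr 1
      ext i j
      simp only [RingHom.mapMatrix_apply, Matrix.map_apply, Matrix.of_apply, map_add, map_mul,
        he, heX, LinearMap.toMatrix'_apply, J]
      by_cases h : i = j <;> simp [h]
  obtain ⟨P, hP⟩ := exists_polynomial_setIntegral_eval₂ volume hK p
  obtain ⟨t₀, ht₀, h⟩ := exists_pos_setIntegral_comp_mul_det_eq volume hg hK hgK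
  have hconst : P = C (∫ x in K, MvPolynomial.eval x ρ) := by
    refine Polynomial.eq_of_infinite_eval_eq _ _ ((Icc_infinite ht₀).mono fun t ht => ?_)
    simp only [mem_ofPred_eq, eval_C]
    rw [← hP t, ← h t ht fun x => MvPolynomial.eval x ρ]
    simp only [hp]
  have h1 := hP 1
  simp only [hp, one_smul] at h1
  rw [h1, hconst, eval_C]

open MeasureTheory Set Filter Topology in
/-- A compactly supported `C¹` map has a fixed point. Otherwise `x - g x` stays away from `0`, and
`setIntegral_comp_mul_det_eq` fails for a large power of `1 - ∑ i, X i ^ 2 / L`, which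
concentrates at `0`. -/
theorem exists_fixedPoint_of_contDiff {ι : Type*} [Fintype ι] {g : (ι → ℝ) → ι → ℝ}
    (hg : ContDiff ℝ 1 g) (hcs : HasCompactSupport g) : ∃ x, g x = x := by
  by_contra! hne
  obtain ⟨R, hR, hRg⟩ : ∃ R > 0, ∀ x ∉ Metric.closedBall (0 : ι → ℝ) R, g x = 0 := by
    obtain ⟨R, hR⟩ := hcs.isCompact.isBounded.subset_closedBall (0 : ι → ℝ)
    refine ⟨max R 1, by positivity, fun x hx => image_eq_zero_of_notMem_tsupport fun h => hx ?_⟩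
    exact Metric.closedBall_subset_closedBall (le_max_left _ _) (hR h)
  set K := Metric.closedBall (0 : ι → ℝ) R
  have hK : IsCompact K := isCompact_closedBall _ _
  have h0K : (0 : ι → ℝ) ∈ K := Metric.mem_closedBall_self hR.le
  let q : (ι → ℝ) → ℝ := fun x => ∑ i, x i ^ 2
  have hq : Continuous q := by fun_prop
  have hq0 : ∀ x, 0 ≤ q x := fun x => Finset.sum_nonneg fun i _ => sq_nonneg _
  have hgc := hg.continuous
  have hqφ : Continuous fun x => q (x - g x) := by fun_prop
  obtain ⟨x₀, -, hx₀⟩ := hK.exists_isMinOn ⟨0, h0K⟩ hqφ.continuousOn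
  set c := q (x₀ - g x₀)
  have hc : 0 < c := by
    refine (hq0 _).lt_of_ne fun h => hne x₀ ?_
    have := (Finset.sum_eq_zero_iff_of_nonneg fun i _ => sq_nonneg _).1 h.symm
    ext i
    have := pow_eq_zero_iff two_ne_zero |>.1 (this i (Finset.mem_univ i))
    simp only [Pi.sub_apply] at this
    linarith
  obtain ⟨L₁, hL₁⟩ := hK.exists_bound_of_continuousOn hqφ.continuousOn
  obtain ⟨L₂, hL₂⟩ := hK.exists_bound_of_continuousOn hq.continuousOn
  let L := max L₁ L₂
  have hcφ : ∀ x ∈ K, c ≤ q (x - g x) := fun x hx => hx₀ hx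
  have hLφ : ∀ x ∈ K, q (x - g x) ≤ L := fun x hx =>
    (le_abs_self _).trans ((hL₁ x hx).trans (le_max_left _ _))
  have hLq : ∀ x ∈ K, q x ≤ L := fun x hx =>
    (le_abs_self _).trans ((hL₂ x hx).trans (le_max_right _ _))
  have hL : 0 < L := hc.trans_le ((hcφ 0 h0K).trans (hLφ 0 h0K))
  have hcL : c ≤ L := (hcφ 0 h0K).trans (hLφ 0 h0K)
  have hdetc : Continuous fun x => (1 + fderiv ℝ (fun x => -g x) x).det :=
    ContinuousLinearMap.continuous_det.comp
      (continuous_const.add ((hg.neg).continuous_fderiv one_ne_zero))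
  obtain ⟨M, hM⟩ := hK.exists_bound_of_continuousOn hdetc.continuousOn
  have hM0 : 0 ≤ M := (norm_nonneg _).trans (hM 0 h0K)
  let U : Set (ι → ℝ) := {x | q x < c / 2} ∩ Metric.ball 0 R
  have hUopen : IsOpen U := (isOpen_lt hq continuous_const).inter Metric.isOpen_ball
  have hU0 : (0 : ι → ℝ) ∈ U := ⟨by simp [q]; positivity, Metric.mem_ball_self hR⟩
  have hUK : U ⊆ K := fun x hx => Metric.ball_subset_closedBall hx.2
  have hUpos : 0 < volume.real U := by
    refine ENNReal.toReal_pos (hUopen.measure_pos volume ⟨0, hU0⟩).ne' ?_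
    exact ((measure_mono hUK).trans_lt hK.measure_lt_top).ne
  have hineq : ∀ k : ℕ, (1 - c / 2 / L) ^ k * volume.real U ≤
      (1 - c / L) ^ k * (M * volume.real K) := by
    intro k
    let ρ : MvPolynomial ι ℝ :=
      (1 - MvPolynomial.C L⁻¹ * ∑ i, MvPolynomial.X i ^ 2) ^ k
    have hρ : ∀ x, MvPolynomial.eval x ρ = (1 - q x / L) ^ k := fun x => by
      simp [ρ, q, div_eq_inv_mul]
    have key := setIntegral_comp_mul_det_eq hg.neg hK (fun x hx => by simp [hRg x hx]) ρ
    simp only [hρ] at key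
    have hint : Continuous fun x => (1 - q x / L) ^ k := by fun_prop
    calc (1 - c / 2 / L) ^ k * volume.real U
        = ∫ x in U, (1 - c / 2 / L) ^ k := by simp [mul_comm]
      _ ≤ ∫ x in U, (1 - q x / L) ^ k := by
          refine setIntegral_mono_on ?_ ?_ hUopen.measurableSet fun x hx => ?_
          · exact (continuousOn_const.integrableOn_compact hK).mono_set hUK
          · exact (hint.continuousOn.integrableOn_compact hK).mono_set hUK
          · have h1 : c / 2 / L ≤ 1 := by rw [div_le_one hL]; linarith
            have h2 : q x / L ≤ c / 2 / L := div_le_div_of_nonneg_right (le_of_lt hx.1) hL.le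
            exact pow_le_pow_left₀ (by linarith) (by linarith) k
      _ ≤ ∫ x in K, (1 - q x / L) ^ k := by
          refine setIntegral_mono_set (hint.continuousOn.integrableOn_compact hK) ?_
            (LE.le.eventuallyLE hUK)
          refine (ae_restrict_iff' hK.measurableSet).2 (Eventually.of_forall fun x hx => ?_)
          have : q x / L ≤ 1 := by rw [div_le_one hL]; exact hLq x hx
          exact pow_nonneg (by linarith) k
      _ = _ := key.symm
      _ ≤ ‖∫ x in K, (1 - q (x + -g x) / L) ^ k * (1 + fderiv ℝ (fun x => -g x) x).det‖ :=
          le_abs_self _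
      _ ≤ (1 - c / L) ^ k * M * volume.real K := by
          refine norm_setIntegral_le_of_norm_le_const hK.measure_lt_top fun x hx => ?_
          rw [norm_mul]
          have h1 : c / L ≤ q (x - g x) / L := div_le_div_of_nonneg_right (hcφ x hx) hL.le
          have h2 : q (x - g x) / L ≤ 1 := by rw [div_le_one hL]; exact hLφ x hx
          have h3 : (0 : ℝ) ≤ 1 - c / L := by
            rw [sub_nonneg, div_le_one hL]; exact hcL
          refine mul_le_mul ?_ (hM x hx) (norm_nonneg _) (pow_nonneg h3 k)
          rw [norm_pow, ← sub_eq_add_neg, Real.norm_of_nonneg (by linarith)]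
          exact pow_le_pow_left₀ (by linarith) (by linarith) k
      _ = _ := by ring
  have hr1 : 0 ≤ 1 - c / L := by rw [sub_nonneg, div_le_one hL]; exact hcL
  have hlt : 1 - c / L < 1 - c / 2 / L := by
    have : c / 2 / L < c / L := div_lt_div_of_pos_right (by linarith) hL
    linarith
  have hr2 : 0 < 1 - c / 2 / L := hr1.trans_lt hlt
  have hlim : Tendsto (fun k : ℕ => ((1 - c / L) / (1 - c / 2 / L)) ^ k * (M * volume.real K))
      atTop (𝓝 (0 * (M * volume.real K))) :=
    (tendsto_pow_atTop_nhds_zero_of_lt_one (by positivity) ((div_lt_one hr2).2 hlt)).mul_const _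
  rw [zero_mul] at hlim
  refine hUpos.not_ge (ge_of_tendsto' hlim fun k => ?_)
  rw [div_pow, div_mul_eq_mul_div, le_div_iff₀ (pow_pos hr2 k), mul_comm]
  exact hineq k

theorem exists_fixedPoint_of_hasCompactSupport {ι : Type*} [Fintype ι]
    {f : (ι → ℝ) → ι → ℝ} (hf : Continuous f) (hcs : HasCompactSupport f) :
    ∃ x, f x = x := by
  by_contra! hne
  have hS : IsCompact (insert 0 (tsupport f)) := hcs.isCompact.insert 0
  obtain ⟨x₀, -, hx₀⟩ := hS.exists_isMinOn (Set.insert_nonempty _ _)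
    (hf.dist continuous_id).continuousOn
  obtain ⟨g, hg, hgf, hsupp⟩ := hf.exists_contDiff_approx 1
    (ε := fun _ => dist (f x₀) x₀) continuous_const fun _ => dist_pos.2 (hne x₀)
  obtain ⟨x, hx⟩ := exists_fixedPoint_of_contDiff hg (hcs.mono hsupp)
  have hxS : x ∈ insert 0 (tsupport f) := by
    by_cases h : g x = 0
    · exact Or.inl (hx.symm.trans h)
    · exact Or.inr (subset_tsupport f (hsupp h))
  have h1 : dist (f x₀) x₀ ≤ dist (f x) x := hx₀ hxS
  have h2 := hgf x
  rw [hx, dist_comm] at h2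
  exact absurd h1 h2.not_ge

/-- A consequence of Brouwer's theorem: a continuous vector field on a box has a point where each
coordinate of the field vanishes or pushes outwards against a face of the box. -/
theorem exists_complementarity_of_continuous {ι : Type*} [Fintype ι] {c : ι → ℝ}
    (hc : 0 ≤ c) {F : (ι → ℝ) → ι → ℝ} (hF : Continuous F) :
    ∃ x ∈ Set.Icc 0 c, ∀ i, (0 < F x i → x i = c i) ∧ (F x i < 0 → x i = 0) := by
  obtain ⟨χ, hχ1, -, hχc, hχ⟩ := exists_continuous_one_zero_of_isCompact
    (isCompact_Icc : IsCompact (Set.Icc 0 c)) isClosed_empty (Set.disjoint_empty _)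
  -- A fixed point lies in the box, as the box contains `0` and is convex; there `χ x = 1`.
  let f : (ι → ℝ) → ι → ℝ := fun x i => χ x * max 0 (min (c i) (x i + F x i))
  have hf : Continuous f := by fun_prop
  have hfc : HasCompactSupport f := hχc.mono fun x hx h => hx <| by
    ext i
    simp [f, h]
  obtain ⟨x, hx⟩ := exists_fixedPoint_of_hasCompactSupport hf hfc
  have hxi : ∀ i, χ x * max 0 (min (c i) (x i + F x i)) = x i := fun i => congrFun hx i
  have hxmem : x ∈ Set.Icc 0 c := by
    refine ⟨fun i => ?_, fun i => ?_⟩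
    · rw [← hxi i]
      exact mul_nonneg (hχ x).1 (le_max_left _ _)
    · rw [← hxi i]
      refine (mul_le_of_le_one_left (le_max_left _ _) (hχ x).2).trans ?_
      exact max_le (hc i) (min_le_left _ _)
  refine ⟨x, hxmem, fun i => ?_⟩
  have h := hxi i
  have h1 : χ x = 1 := hχ1 hxmem
  have h2 : 0 ≤ x i := hxmem.1 i
  have h3 : x i ≤ c i := hxmem.2 i
  rw [h1, one_mul] at h
  grind

/-! ### Logit demand and market clearing -/

/-- The softmax (logit) distribution on `G` with weights proportional to `exp (v j)`. -/
noncomputable def softmax {G : Type*} [Fintype G] (v : G → ℝ) (j : G) : ℝ :=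
  Real.exp (v j) / ∑ k, Real.exp (v k)

section Softmax

variable {G : Type*} [Fintype G]

theorem softmax_nonneg (v : G → ℝ) (j : G) : 0 ≤ softmax v j :=
  div_nonneg (Real.exp_nonneg _) (Finset.sum_nonneg fun _ _ => Real.exp_nonneg _)

theorem sum_exp_pos [Nonempty G] (v : G → ℝ) : 0 < ∑ k, Real.exp (v k) :=
  Finset.sum_pos (fun _ _ => Real.exp_pos _) Finset.univ_nonempty

theorem sum_softmax [Nonempty G] (v : G → ℝ) : ∑ j, softmax v j = 1 := by
  simp only [softmax]
  rw [← Finset.sum_div, div_self (sum_exp_pos v).ne']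

theorem isBundle_softmax [Nonempty G] (v : G → ℝ) : IsBundle (softmax v) :=
  ⟨softmax_nonneg v, sum_softmax v⟩

theorem softmax_le_one [Nonempty G] (v : G → ℝ) (j : G) : softmax v j ≤ 1 :=
  sum_softmax v ▸ Finset.single_le_sum (fun k _ => softmax_nonneg v k) (Finset.mem_univ j)

theorem softmax_le_exp_sub (v : G → ℝ) (j k : G) : softmax v j ≤ Real.exp (v j - v k) := by
  rw [Real.exp_sub]
  exact div_le_div_of_nonneg_left (Real.exp_nonneg _) (Real.exp_pos _)
    (Finset.single_le_sum (f := fun k => Real.exp (v k)) (fun _ _ => Real.exp_nonneg _)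
      (Finset.mem_univ k))

theorem Continuous.softmax [Nonempty G] {X : Type*} [TopologicalSpace X] {v : X → G → ℝ}
    (hv : Continuous v) (j : G) : Continuous fun x => softmax (v x) j := by
  unfold _root_.softmax
  exact Continuous.div (by fun_prop) (by fun_prop) fun x => (sum_exp_pos (v x)).ne'

/-- If some item is free, the logit demand at cost sensitivity `l` and temperature `ε ≤ 1` spends on
each item at most of order `1 / l`, uniformly in the temperature. -/
theorem mul_cost_softmax_le [Nonempty G] {w p : G → ℝ} {U l ε : ℝ} (hw : ∀ j, |w j| ≤ U)
    (hp : ∀ j, 0 ≤ p j) {k : G} (hk : p k = 0) (hl : 0 ≤ l) (hε : 0 < ε) (hε1 : ε ≤ 1)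
    (j : G) : l * (p j * softmax (fun j => (w j - l * p j) / ε) j) ≤ 2 * U + 1 := by
  set y := softmax (fun j => (w j - l * p j) / ε) j with hy
  have hy0 : 0 ≤ y := softmax_nonneg _ _
  have hy1 : y ≤ 1 := softmax_le_one _ _
  have hU : 0 ≤ U := (abs_nonneg _).trans (hw k)
  have hlp : 0 ≤ l * p j := mul_nonneg hl (hp j)
  rw [← mul_assoc]
  rcases le_total (l * p j) (2 * U) with h | h
  · nlinarith
  · set s := l * p j - 2 * U with hs
    have hs0 : 0 ≤ s := sub_nonneg.2 h
    have hexp : y ≤ Real.exp (-s) := by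
      refine (softmax_le_exp_sub _ j k).trans (Real.exp_le_exp.2 ?_)
      rw [← sub_div, hk, div_le_iff₀ hε]
      have h1 := (abs_le.1 (hw j)).2
      have h2 := (abs_le.1 (hw k)).1
      nlinarith
    have hys : y * (1 + s) ≤ 1 := by
      have h1 : 1 + s ≤ Real.exp s := by linarith [Real.add_one_le_exp s]
      calc y * (1 + s) ≤ Real.exp (-s) * Real.exp s := by gcongr
        _ = 1 := by rw [← Real.exp_add]; simp
    nlinarith

end Softmax

/-- Market clearing for logit demand. Agent `i` weighs costs by the multiplier `l i`, which exceeds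
its least value `δ` only if the whole budget `1` is spent; prices and multipliers come from
`exists_complementarity_of_continuous`. The bound on `l` does not depend on `ε`. -/
theorem exists_regularized_equilibrium {A G : Type*} [Fintype A] [Fintype G] [Nonempty G]
    (hcard : Fintype.card A = Fintype.card G) {u : A → G → ℝ} {U : ℝ}
    (hU : ∀ i j, |u i j| ≤ U) {Λ δ ε : ℝ} (hΛ : Fintype.card G * (2 * U + 1) < Λ)
    (hδ : 0 < δ) (hε : 0 < ε) (hε1 : ε ≤ 1) :
    ∃ (p : G → ℝ) (l : A → ℝ) (x : A → G → ℝ), (∀ j, 0 ≤ p j) ∧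
      (∀ i, δ ≤ l i ∧ l i ≤ δ + Λ) ∧
      (∀ i, x i = softmax fun j => (u i j - l i * p j) / ε) ∧
      (∀ j, ∑ i, x i j = 1) ∧ ∀ i, p ⬝ᵥ x i ≤ 1 ∧ (δ < l i → p ⬝ᵥ x i = 1) := by
  obtain ⟨n, hn⟩ : ∃ n : ℝ, n = (Fintype.card G : ℝ) := ⟨_, rfl⟩
  rw [← hn] at hΛ
  have hn0 : 0 ≤ n := hn ▸ Nat.cast_nonneg _
  have hA : (Fintype.card A : ℝ) = n := by rw [hn, hcard]
  rcases isEmpty_or_nonempty A with hAe | ⟨⟨a₀⟩⟩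
  · exact absurd hcard (by simp [Fintype.card_eq_zero, Fintype.card_ne_zero.symm])
  have hU0 : 0 ≤ U := (abs_nonneg _).trans (hU a₀ (Classical.arbitrary G))
  have hΛ0 : 0 < Λ := lt_of_le_of_lt (by positivity) hΛ
  -- Only price differences enter, measured from the cheapest item.
  let P : (G ⊕ A → ℝ) → G → ℝ := fun z j =>
    z (.inl j) - Finset.univ.inf' Finset.univ_nonempty fun k => z (.inl k)
  let X : (G ⊕ A → ℝ) → A → G → ℝ := fun z i =>
    softmax fun j => (u i j - (δ + z (.inr i)) * P z j) / ε
  let F : (G ⊕ A → ℝ) → G ⊕ A → ℝ := fun z =>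
    Sum.elim (fun j => ∑ i, X z i j - 1) fun i => P z ⬝ᵥ X z i - 1
  have hPc : ∀ j, Continuous fun z => P z j := fun j =>
    (continuous_apply _).sub
      (Continuous.finset_inf'_apply _ fun k _ => continuous_apply (Sum.inl k))
  have hXc : ∀ i j, Continuous fun z => X z i j := fun i j =>
    Continuous.softmax (by fun_prop) j
  have hF : Continuous F := by
    refine continuous_pi fun s => ?_
    rcases s with j | i
    · simp only [F, Sum.elim_inl]
      fun_prop
    · simp only [F, Sum.elim_inr, dotProduct]
      fun_prop
  obtain ⟨z, ⟨hz0, hzc⟩, hz⟩ := exists_complementarity_of_continuous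
    (c := Sum.elim (fun _ => n + 1) fun _ => Λ)
    (by rintro (j | i) <;> simp <;> positivity) hF
  have hP0 : ∀ j, 0 ≤ P z j := fun j =>
    sub_nonneg.2 (Finset.inf'_le (fun k => z (.inl k)) (Finset.mem_univ j))
  obtain ⟨k₀, hk₀⟩ : ∃ k, P z k = 0 := by
    obtain ⟨k, -, hk⟩ := Finset.exists_mem_eq_inf' Finset.univ_nonempty fun k => z (.inl k)
    exact ⟨k, sub_eq_zero.2 hk.symm⟩
  have hl0 : ∀ i, 0 ≤ z (.inr i) := fun i => hz0 (.inr i)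
  -- At the upper bound for the multiplier, agents buy almost only the cheapest items.
  have hspend : ∀ i, P z ⬝ᵥ X z i ≤ 1 := by
    intro i
    by_contra! h
    have hΛi : z (.inr i) = Λ := (hz (.inr i)).1 (by simp only [F, Sum.elim_inr]; linarith)
    have hl : 0 ≤ δ + z (.inr i) := by linarith
    have : (δ + z (.inr i)) * P z ⬝ᵥ X z i ≤ n * (2 * U + 1) := by
      rw [dotProduct, Finset.mul_sum, hn, ← nsmul_eq_mul]
      exact Finset.sum_le_card_nsmul _ _ _ fun j _ =>
        mul_cost_softmax_le (hU i) hP0 hk₀ hl hε hε1 j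
    nlinarith
  have hclear : ∀ j, ∑ i, X z i j = 1 := by
    have hsum : ∑ j, (∑ i, X z i j - 1) = 0 := by
      rw [Finset.sum_sub_distrib, Finset.sum_comm]
      simp only [X, sum_softmax]
      simp [hcard]
    by_contra! ⟨j, hj⟩
    have hj' : ∃ j ∈ Finset.univ, ∑ i, X z i j - 1 ≠ 0 := ⟨j, Finset.mem_univ j, sub_ne_zero.2 hj⟩
    -- An overdemanded item is priced at `n + 1` and some other item at `0`, so the demand for the
    -- former costs more than the total budget `n`.
    obtain ⟨a, -, ha⟩ := Finset.exists_pos_of_sum_zero_of_exists_nonzero _ hsum hj'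
    obtain ⟨b, -, hb⟩ : ∃ b ∈ Finset.univ, ∑ i, X z i b - 1 < 0 := by
      by_contra! h
      have := Finset.sum_pos' h ⟨a, Finset.mem_univ a, ha⟩
      linarith
    have hza : z (.inl a) = n + 1 := (hz (.inl a)).1 ha
    have hzb : z (.inl b) = 0 := (hz (.inl b)).2 hb
    have hPa : n + 1 ≤ P z a := by
      have := Finset.inf'_le (fun k => z (.inl k)) (Finset.mem_univ b)
      simp only [P]
      linarith
    have h1 : ∑ i, P z ⬝ᵥ X z i ≤ n := by
      rw [← hA, ← nsmul_one]
      exact Finset.sum_le_card_nsmul _ _ _ fun i _ => hspend i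
    have h2 : ∑ i, P z ⬝ᵥ X z i = ∑ j, P z j * ∑ i, X z i j := by
      simp only [dotProduct, Finset.mul_sum]
      exact Finset.sum_comm
    have h3 : P z a * ∑ i, X z i a ≤ ∑ j, P z j * ∑ i, X z i j :=
      Finset.single_le_sum (f := fun j => P z j * ∑ i, X z i j)
        (fun j _ => mul_nonneg (hP0 j) (Finset.sum_nonneg fun i _ => softmax_nonneg _ _))
        (Finset.mem_univ a)
    nlinarith
  refine ⟨P z, fun i => δ + z (.inr i), X z, hP0, fun i => ⟨?_, ?_⟩, fun i => rfl, hclear,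
    fun i => ⟨hspend i, fun h => ?_⟩⟩
  · linarith [hl0 i]
  · have : z (.inr i) ≤ Λ := hzc (.inr i)
    linarith
  · refine (hspend i).antisymm ?_
    by_contra! h'
    have := (hz (.inr i)).2 (by simp only [F, Sum.elim_inr]; linarith)
    linarith

/-! ### Vanishing temperature -/

open Filter Topology in
/-- The limit of the logit equilibria as `δ → 0`. Each agent buys only items that maximize
`u i j - l i * p j`, and among items of equal utility only the cheapest; the last clause has
content where `l i = 0`, since along the sequence the multipliers are positive. -/
theorem exists_supported_equilibrium {A G : Type*} [Fintype A] [Fintype G] [Nonempty G]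
    (hcard : Fintype.card A = Fintype.card G) (u : A → G → ℝ) :
    ∃ (p : G → ℝ) (l : A → ℝ) (x : A → G → ℝ), (∀ j, 0 ≤ p j) ∧ (∀ i, 0 ≤ l i) ∧
      (∀ i, IsBundle (x i)) ∧ (∀ j, ∑ i, x i j = 1) ∧ (∀ i, p ⬝ᵥ x i ≤ 1) ∧
      (∀ i, 0 < l i → p ⬝ᵥ x i = 1) ∧
      (∀ i j k, u i j - l i * p j < u i k - l i * p k → x i j = 0) ∧
      ∀ i j k, u i j = u i k → p k < p j → x i j = 0 := by
  obtain ⟨U, hU⟩ : ∃ U, ∀ i j, |u i j| ≤ U := by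
    obtain ⟨U, hU⟩ := Finite.exists_le fun a : A × G => |u a.1 a.2|
    exact ⟨U, fun i j => hU (i, j)⟩
  obtain ⟨Λ, hΛ⟩ := exists_gt ((Fintype.card G : ℝ) * (2 * U + 1))
  let δ : ℕ → ℝ := fun m => 1 / ((m : ℝ) + 1)
  have hδ : ∀ m, 0 < δ m := fun m => Nat.one_div_pos_of_nat
  have hδ1 : ∀ m, δ m ≤ 1 := fun m => by
    simp only [δ]
    rw [div_le_one (by positivity)]
    linarith [(Nat.cast_nonneg m : (0 : ℝ) ≤ m)]
  have hδ0 : Tendsto δ atTop (𝓝 0) := tendsto_one_div_add_atTop_nhds_zero_nat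
  -- The temperature `δ ^ 2` is small even compared with the least cost sensitivity `δ`.
  choose p l x hp hl hx hclear hspend using fun m =>
    exists_regularized_equilibrium hcard hU hΛ (hδ m) (pow_pos (hδ m) 2)
      (pow_le_one₀ (hδ m).le (hδ1 m))
  have hxb : ∀ m i, IsBundle (x m i) := fun m i => hx m i ▸ isBundle_softmax _
  have hx1 : ∀ m i j, x m i j ≤ 1 := fun m i j => by
    rw [hx m i]; exact softmax_le_one _ _
  have hpn : ∀ m j, p m j ≤ Fintype.card A := fun m j => by
    calc p m j ≤ ∑ j, p m j := Finset.single_le_sum (fun j _ => hp m j) (Finset.mem_univ j)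
      _ = ∑ j, p m j * ∑ i, x m i j := by simp [hclear]
      _ = ∑ i, p m ⬝ᵥ x m i := by
        simp only [dotProduct, Finset.mul_sum]
        exact Finset.sum_comm
      _ ≤ Fintype.card A • 1 := Finset.sum_le_card_nsmul _ _ _ fun i _ => (hspend m i).1
      _ = _ := by simp
  obtain ⟨⟨p', l', x'⟩, -, s, hs, hlim⟩ := (isCompact_Icc : IsCompact (Set.Icc
    (0 : (G → ℝ) × (A → ℝ) × (A → G → ℝ))
    (fun _ => (Fintype.card A : ℝ), fun _ => 1 + Λ, fun _ _ => 1))).tendsto_subseq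
    (x := fun m => (p m, l m, x m)) fun m =>
      ⟨⟨hp m, fun i => (hδ m).le.trans (hl m i).1, fun i => (hxb m i).nonneg⟩,
        ⟨hpn m, fun i => (hl m i).2.trans (by linarith [hδ1 m]), hx1 m⟩⟩
  have hδs : Tendsto (fun m => δ (s m)) atTop (𝓝 0) := hδ0.comp hs.tendsto_atTop
  have hlimp : ∀ j, Tendsto (fun m => p (s m) j) atTop (𝓝 (p' j)) := fun j =>
    ((continuous_apply j).comp continuous_fst).continuousAt.tendsto.comp hlim
  have hliml : ∀ i, Tendsto (fun m => l (s m) i) atTop (𝓝 (l' i)) := fun i =>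
    ((continuous_apply i).comp (continuous_fst.comp continuous_snd)).continuousAt.tendsto.comp
      hlim
  have hlimx : ∀ i j, Tendsto (fun m => x (s m) i j) atTop (𝓝 (x' i j)) := fun i j =>
    ((continuous_apply_apply i j).comp
      (continuous_snd.comp continuous_snd)).continuousAt.tendsto.comp hlim
  have hlimpx : ∀ i, Tendsto (fun m => p (s m) ⬝ᵥ x (s m) i) atTop (𝓝 (p' ⬝ᵥ x' i)) := fun i =>
    tendsto_finsetSum _ fun j _ => (hlimp j).mul (hlimx i j)
  have hx'0 : ∀ i j, 0 ≤ x' i j := fun i j =>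
    ge_of_tendsto' (hlimx i j) fun m => (hxb (s m) i).nonneg j
  have hinv : Tendsto (fun m => (δ (s m))⁻¹) atTop atTop :=
    (tendsto_nhdsWithin_iff.2 ⟨hδs, Eventually.of_forall fun m => hδ (s m)⟩).inv_tendsto_nhdsGT_zero
  -- An item that loses to another by at least `c * δ` gets vanishing weight.
  have hvanish : ∀ i j k (c : ℝ), 0 < c → (∀ᶠ m in atTop,
      (u i j - l (s m) i * p (s m) j) - (u i k - l (s m) i * p (s m) k) ≤ -(c * δ (s m))) →
      x' i j = 0 := by
    intro i j k c hc h
    have hexp : Tendsto (fun m => Real.exp (-(c * (δ (s m))⁻¹))) atTop (𝓝 0) :=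
      Real.tendsto_exp_neg_atTop_nhds_zero.comp (hinv.const_mul_atTop hc)
    refine (ge_of_tendsto (hlimx i j) (Eventually.of_forall fun m =>
      (hxb (s m) i).nonneg j)).antisymm' (le_of_tendsto_of_tendsto (hlimx i j) hexp ?_)
    filter_upwards [h] with m hm
    rw [hx (s m) i]
    refine (softmax_le_exp_sub _ j k).trans (Real.exp_le_exp.2 ?_)
    have hd := hδ (s m)
    rw [← sub_div, div_le_iff₀ (pow_pos hd 2)]
    refine hm.trans_eq ?_
    field_simp
  refine ⟨p', l', x', fun j => ge_of_tendsto' (hlimp j) fun m => hp (s m) j, fun i =>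
    ge_of_tendsto' (hliml i) fun m => (hδ _).le.trans (hl (s m) i).1,
    fun i => ⟨hx'0 i, ?_⟩, fun j => ?_, fun i => le_of_tendsto' (hlimpx i) fun m =>
    (hspend (s m) i).1, fun i hi => ?_, fun i j k h => ?_, fun i j k h hjk => ?_⟩
  · refine tendsto_nhds_unique (tendsto_finsetSum _ fun j _ => hlimx i j) ?_
    simp [(hxb _ i).sum_eq_one]
  · refine tendsto_nhds_unique (tendsto_finsetSum _ fun i _ => hlimx i j) ?_
    simp [hclear]
  · refine tendsto_nhds_unique (hlimpx i) (tendsto_const_nhds.congr' ?_)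
    filter_upwards [hδs.eventually_lt (hliml i) hi] with m hm
    exact ((hspend (s m) i).2 hm).symm
  · have hv : ∀ j, Tendsto (fun m => u i j - l (s m) i * p (s m) j) atTop
        (𝓝 (u i j - l' i * p' j)) := fun j => ((hliml i).mul (hlimp j)).const_sub _
    refine hvanish i j k 1 one_pos ?_
    have hlt : (u i j - l' i * p' j) - (u i k - l' i * p' k) < -(1 * 0) := by linarith
    filter_upwards [((hv j).sub (hv k)).eventually_lt (hδs.const_mul 1).neg hlt] with m hm
    exact hm.le
  · have hc : 0 < (p' j - p' k) / 2 := by linarith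
    refine hvanish i j k _ hc ?_
    filter_upwards [((hlimp j).sub (hlimp k)).eventually_const_lt (half_lt_self (sub_pos.2 hjk))]
      with m hm
    have := (hl (s m) i).1
    have := hδ (s m)
    rw [h]
    nlinarith

/-! ### Optimality of supported bundles and the change of payments -/

theorem dotProduct_sub_dotProduct_eq {G : Type*} [Fintype G] {x y : G → ℝ} (hx : IsBundle x)
    (hy : IsBundle y) (f : G → ℝ) :
    f ⬝ᵥ x - f ⬝ᵥ y = ∑ j, ∑ k, x j * y k * (f j - f k) := by
  have h1 : ∑ j, ∑ k, x j * y k * f j = f ⬝ᵥ x := by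
    refine Finset.sum_congr rfl fun j _ => ?_
    rw [← Finset.sum_mul, ← Finset.mul_sum, hy.sum_eq_one]
    ring
  have h2 : ∑ j, ∑ k, x j * y k * f k = f ⬝ᵥ y := by
    rw [Finset.sum_comm]
    refine Finset.sum_congr rfl fun k _ => ?_
    rw [← Finset.sum_mul, ← Finset.sum_mul, hx.sum_eq_one]
    ring
  simp only [mul_sub, Finset.sum_sub_distrib, h1, h2]

/-- A bundle supported on maximizers of `w - l • p`, and on cheapest items among those of equal
utility, with the budget spent if `l > 0`, is a cheapest optimal bundle within the budget. -/
theorem IsBundle.optimal_and_cheapest {G : Type*} [Fintype G] {x y w p : G → ℝ} {l : ℝ}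
    (hx : IsBundle x) (hy : IsBundle y) (hl : 0 ≤ l) (hlx : 0 < l → p ⬝ᵥ x = 1)
    (harg : ∀ j k, w j - l * p j < w k - l * p k → x j = 0)
    (hcheap : ∀ j k, w j = w k → p k < p j → x j = 0) (hpy : p ⬝ᵥ y ≤ 1) :
    w ⬝ᵥ y ≤ w ⬝ᵥ x ∧ (w ⬝ᵥ y = w ⬝ᵥ x → p ⬝ᵥ x ≤ p ⬝ᵥ y) := by
  have hterm : ∀ j k, 0 ≤ x j * y k * ((w j - l * p j) - (w k - l * p k)) := fun j k => by
    rcases lt_or_ge (w j - l * p j) (w k - l * p k) with h | h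
    · simp [harg j k h]
    · exact mul_nonneg (mul_nonneg (hx.nonneg j) (hy.nonneg k)) (sub_nonneg.2 h)
  have hsum := dotProduct_sub_dotProduct_eq hx hy fun j => w j - l * p j
  have hsplit : ∀ b : G → ℝ, (fun j => w j - l * p j) ⬝ᵥ b = w ⬝ᵥ b - l * p ⬝ᵥ b := fun b => by
    simp only [dotProduct, sub_mul, Finset.sum_sub_distrib, Finset.mul_sum, mul_assoc]
  rw [hsplit, hsplit] at hsum
  have hnonneg : 0 ≤ w ⬝ᵥ x - l * p ⬝ᵥ x - (w ⬝ᵥ y - l * p ⬝ᵥ y) :=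
    hsum ▸ Finset.sum_nonneg fun j _ => Finset.sum_nonneg fun k _ => hterm j k
  rcases hl.eq_or_lt with rfl | hl
  · simp only [zero_mul, sub_zero] at hterm hsum hnonneg
    refine ⟨by linarith, fun heq => ?_⟩
    rw [heq, sub_self] at hsum
    -- The utilities agree, so every item in the support of `y` is as good as any in that of `x`.
    have hzero : ∀ j k, x j * y k * (w j - w k) = 0 := fun j k => by
      have h1 := (Finset.sum_eq_zero_iff_of_nonneg fun j _ =>
        Finset.sum_nonneg fun k _ => hterm j k).1 hsum.symm j (Finset.mem_univ j)
      exact (Finset.sum_eq_zero_iff_of_nonneg fun k _ => hterm j k).1 h1 k (Finset.mem_univ k)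
    rw [← sub_nonpos, dotProduct_sub_dotProduct_eq hx hy]
    refine Finset.sum_nonpos fun j _ => Finset.sum_nonpos fun k _ => ?_
    rcases mul_eq_zero.1 (hzero j k) with h | h
    · simp [h]
    · rcases lt_or_ge (p k) (p j) with h' | h'
      · simp [hcheap j k (sub_eq_zero.1 h) h']
      · exact mul_nonpos_of_nonneg_of_nonpos (mul_nonneg (hx.nonneg j) (hy.nonneg k))
          (sub_nonpos.2 h')
  · rw [hlx hl] at hnonneg ⊢
    refine ⟨by nlinarith, fun heq => ?_⟩
    rw [heq] at hnonneg
    nlinarith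

theorem mainTheorem2 {A G : Type*} [Fintype A] [Fintype G]
    (hcard : Fintype.card A = Fintype.card G) (u : A → G → ℝ) :
    ∃ (x : A → G → ℝ) (p : G → ℝ), IsHZEarningsEquilibrium u x p := by
  rcases isEmpty_or_nonempty G with hG | hG
  · have hA : IsEmpty A := Fintype.card_eq_zero_iff.1 (hcard.trans Fintype.card_eq_zero)
    exact ⟨fun _ _ => 0, fun _ => 0, isEmptyElim, isEmptyElim, isEmptyElim, isEmptyElim,
      isEmptyElim, isEmptyElim, isEmptyElim⟩
  obtain ⟨q, l, x, hq, hl, hx, hclear, hspend, hspend1, harg, hcheap⟩ :=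
    exists_supported_equilibrium hcard u
  have hQ : 0 ≤ ∑ j, q j := Finset.sum_nonneg fun j _ => hq j
  -- The payment for an item is `1 + s * (1 - q j)`, with `s` so small that it is non-negative.
  obtain ⟨s, hs, hsq⟩ : ∃ s : ℝ, 0 < s ∧ ∀ j, s * q j ≤ 1 := by
    refine ⟨(1 + ∑ j, q j)⁻¹, by positivity, fun j => ?_⟩
    rw [inv_mul_le_iff₀ (by positivity)]
    linarith [Finset.single_le_sum (fun j _ => hq j) (Finset.mem_univ j)]
  have hpay : ∀ y, IsBundle y →
      (fun j => 1 + s * (1 - q j)) ⬝ᵥ y = 1 + s * (1 - q ⬝ᵥ y) := fun y hy => by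
    have : ∀ j, (1 + s * (1 - q j)) * y j = (1 + s) * y j - s * (q j * y j) := fun j => by ring
    simp only [dotProduct, this, Finset.sum_sub_distrib, ← Finset.mul_sum, hy.sum_eq_one]
    ring
  have hafford : ∀ y, IsBundle y → 1 ≤ (fun j => 1 + s * (1 - q j)) ⬝ᵥ y → q ⬝ᵥ y ≤ 1 :=
    fun y hy h => by
      rw [hpay y hy] at h
      nlinarith
  have hopt := fun i y (hy : IsBundle y) h =>
    (hx i).optimal_and_cheapest (w := u i) hy (hl i) (hspend1 i) (harg i) (hcheap i)
      (hafford y hy h)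
  refine ⟨x, fun j => 1 + s * (1 - q j), fun i => (hx i).nonneg, fun j => ?_,
    fun i => (hx i).sum_eq_one, hclear, fun i => ?_, fun i y hy h => (hopt i y hy h).1,
    fun i y hy h heq => ?_⟩
  · linarith [hsq j]
  · rw [hpay _ (hx i)]
    nlinarith [hspend i]
  · rw [hpay _ hy, hpay _ (hx i)]
    have := (hopt i y hy h).2 heq
    nlinarith
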